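/- **Setting.** Let $n\ge 1$ and let $W=(w_{ij})$ be a symmetric $n\times n$ matrix of non-negative similarities, $D$ the diagonal matrix with $d_i=\sum_j w_{ij}$, $L=D-W$ the graph Laplacian and $\lambda_M(L)$ its largest eigenvalue. Let $y_1,\dots,y_n\in\{-1,1\}$ be the true labels of the $n$ vertices, $\gamma_g\ge 0$ and $0<c_u<1$. For a set $l$ of labeled vertices let $C$ be the diagonal matrix with $C_{ii}=1$ for $i\in l$ and $C_{ii}=c_u$ otherwise, let $\mathbf y^{l}$ be the vector of pseudo-targets ($y^{l}_i=y_i$ for $i\in l$ and $y^{l}_i=0$ otherwise), and let $\ell^\ast$ be a solution of $$\min_{\ell\in\mathbb R^n}\ (\ell-\mathbf y^{l})^{\mathsf T}C(\ell-\mathbf y^{l})+\ell^{\mathsf T}(L+\gamma_g I)\ell .$$ For a sample $S=(s_1,\dots,s_{n_l})$ of $n_l\ge 1$ vertices, whose labeled set is $l=\{s_1,\dots,s_{n_l}\}$, put $$R(\ell^\ast)=\frac1n\sum_{i=1}^n(\ell^\ast_i-y_i)^2,\qquad \widehat R(\ell^\ast)=\frac1{n_l}\sum_{k=1}^{n_l}(\ell^\ast_{s_k}-y_{s_k})^2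 .$$ Let $\beta$ be the uniform stability coefficient of the solution, i.e. the supremum of $|(\ell^\ast_i-y_i)^2-(\ell'^{\ast}_i-y_i)^2|$ over all vertices $i$ and all pairs of samples of size $n_l$ that differ in at most one example, with solutions $\ell^\ast$ and $\ell'^\ast$. For $a>0$ let $$B_a=2\left[\frac{a}{\gamma_g+1}+\sqrt{2n_l}\,\frac{1-\sqrt{c_u}}{\sqrt{c_u}}\,\frac{\lambda_M(L)+\gamma_g}{\gamma_g^2+1}\right],\qquad \Delta_T(\beta,n_l,\delta)=\beta+\sqrt{\frac{2\ln(2/\delta)}{n_l}}\,(n_l\beta+4).$$ **Lemma.** 1. For every labeled set the solution $\ell^\ast$ exists and is unique, and the supremum $\beta$ is finite. 2. $\beta\le B_2$ always, and $\beta\le B_{\sqrt2}$ whenever $\lambda_M(L)+\gamma_g\ge 1$. 3. If the labeled examples $s_1,\dots,s_{n_l}$ are selected i.i.d. uniformly from the $n$ vertices and $0<\delta<1$, then with probability at least $1-\delta$ $$R(\ell^\ast)\le\widehat R(\ell^\ast)+\Delta_T(\beta,n_l,\delta),$$ and likewise with probability at least $1-\delta$, $R(\ell^\ast)\le\widehat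 R(\ell^\ast)+\Delta_T(B_{\sqrt2},n_l,\delta)$ (without any condition on $\lambda_M(L)+\gamma_g$). 4. $\beta=O(1/n_l)$ when $\gamma_g=\Omega(n_l^{3/2})$: for every $\kappa>0$ there is a $K$, depending on $\kappa$ only, such that $\beta\le K/n_l$ for every such problem with $\gamma_g\ge\kappa n_l^{3/2}$. The same holds for $B_{\sqrt2}$ in place of $\beta$, with $K$ depending on $\kappa$, $c$ and $M$ only, for all problems with moreover $c_u\ge c>0$ and $\lambda_M(L)\le M\gamma_g$. -/

import Mathlib

open MeasureTheory ProbabilityTheory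

/-- A soft harmonic problem on the vertices `0, …, n - 1`: a weighted data adjacency graph with
symmetric non-negative similarities `W`, the true labels `y i ∈ {-1, 1}` of all vertices, the weight
`cu` of the unlabeled vertices (labeled vertices have weight `1 > cu`) and the regularizer `γ`. -/
structure SoftHarmonicProblem (n : ℕ) where
  W : Matrix (Fin n) (Fin n) ℝ
  W_symm : ∀ i j, W i j = W j i
  W_nonneg : ∀ i j, 0 ≤ W i j
  y : Fin n → ℝ
  y_mem : ∀ i, y i = -1 ∨ y i = 1
  cu : ℝ
  cu_pos : 0 < cu
  cu_lt_one : cu < 1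
  γ : ℝ
  γ_nonneg : 0 ≤ γ

noncomputable section

namespace SoftHarmonicProblem

open scoped Classical in
/-- The diagonal of `C`: weight `1` on the labeled set `l` and `cu` elsewhere. -/
def weight {n : ℕ} (p : SoftHarmonicProblem n) (l : Set (Fin n)) (i : Fin n) : ℝ :=
  if i ∈ l then 1 else p.cu

open scoped Classical in
/-- The pseudo-targets: the true label on the labeled set `l` and `0` elsewhere. -/
def target {n : ℕ} (p : SoftHarmonicProblem n) (l : Set (Fin n)) (i : Fin n) : ℝ :=
  if i ∈ l then p.y i else 0

/-- The graph Laplacian `L = D - W`, where `D` is the diagonal matrix of the row sums of `W`. -/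
def laplacian {n : ℕ} (p : SoftHarmonicProblem n) : Matrix (Fin n) (Fin n) ℝ :=
  Matrix.diagonal (fun i => ∑ j, p.W i j) - p.W

/-- The largest eigenvalue of the (symmetric) Laplacian. -/
def lambdaMax {n : ℕ} (p : SoftHarmonicProblem n) : ℝ :=
  sSup {μ : ℝ | Module.End.HasEigenvalue (Matrix.toLin' p.laplacian) μ}

/-- `(ℓ - t)ᵀ C (ℓ - t) + ℓᵀ (L + γ I) ℓ`, where `t` is the vector of pseudo-targets. -/
def objective {n : ℕ} (p : SoftHarmonicProblem n) (l : Set (Fin n)) (ℓ : Fin n → ℝ) : ℝ :=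
  (ℓ - p.target l) ⬝ᵥ (Matrix.diagonal (p.weight l)).mulVec (ℓ - p.target l) +
    ℓ ⬝ᵥ (p.laplacian + p.γ • (1 : Matrix (Fin n) (Fin n) ℝ)).mulVec ℓ

/-- `ℓ` solves the soft harmonic problem whose labeled set is `l`. -/
def IsSolution {n : ℕ} (p : SoftHarmonicProblem n) (l : Set (Fin n)) (ℓ : Fin n → ℝ) : Prop :=
  ∀ ℓ' : Fin n → ℝ, p.objective l ℓ ≤ p.objective l ℓ'

/-- Squared error of the prediction `ℓ` at the vertex `i`. -/
def cost {n : ℕ} (p : SoftHarmonicProblem n) (ℓ : Fin n → ℝ) (i : Fin n) : ℝ :=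
  (ℓ i - p.y i) ^ 2

/-- Risk over all vertices. -/
def risk {n : ℕ} (p : SoftHarmonicProblem n) (ℓ : Fin n → ℝ) : ℝ :=
  (1 / (n : ℝ)) * ∑ i, p.cost ℓ i

/-- Empirical risk on a sample `S` of `nl` labeled vertices. -/
def empiricalRisk {n nl : ℕ} (p : SoftHarmonicProblem n) (S : Fin nl → Fin n)
    (ℓ : Fin n → ℝ) : ℝ :=
  (1 / (nl : ℝ)) * ∑ k, p.cost ℓ (S k)

/-- All the changes of the cost at a vertex that are caused by replacing one example of a sample
of `nl` labeled vertices. -/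
def costChanges {n : ℕ} (p : SoftHarmonicProblem n) (nl : ℕ) : Set ℝ :=
  {r | ∃ (S S' : Fin nl → Fin n) (ℓ ℓ' : Fin n → ℝ) (i : Fin n),
    (∃ k, ∀ j, j ≠ k → S j = S' j) ∧
    p.IsSolution (Set.range S) ℓ ∧ p.IsSolution (Set.range S') ℓ' ∧
    r = |p.cost ℓ i - p.cost ℓ' i|}

/-- The (uniform, replace-one) stability coefficient `β` of the soft harmonic solution. -/
def stability {n : ℕ} (p : SoftHarmonicProblem n) (nl : ℕ) : ℝ :=
  sSup (p.costChanges nl)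

/-- `2 [ a / (γ + 1) + √(2 nl) (1 - √cu) / √cu · (λ_max(L) + γ) / (γ² + 1) ]`. -/
def stabilityBound {n : ℕ} (p : SoftHarmonicProblem n) (nl : ℕ) (a : ℝ) : ℝ :=
  2 * (a / (p.γ + 1) +
    √(2 * (nl : ℝ)) * ((1 - √p.cu) / √p.cu) * ((p.lambdaMax + p.γ) / (p.γ ^ 2 + 1)))

end SoftHarmonicProblem

/-- The transductive error `Δ_T(β, nl, δ)`. -/
def transductiveError (β : ℝ) (nl : ℕ) (δ : ℝ) : ℝ :=
  β + √(2 * Real.log (2 / δ) / (nl : ℝ)) * ((nl : ℝ) * β + 4)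

end

/-! Since `C` fixes the pseudo-targets, the minimizer solves the linear system `(C + L + γ I) ℓ =
t`, whose matrix is symmetric and bounded below by `cu > 0` (`isSolution_iff`).

Stability rests on a maximum principle instead of norm estimates. For two labeled sets `l`, `l'`
that differ by one swap, both predictions at a vertex `i` are expanded in the same Green function of
the system for `l ∪ l'` (`exists_green`), which is non-negative, largest at `i` and of weighted mass
1. Put `m = 1 / (1 + γ)`. The common labels contribute the same amount to both predictions, the
swapped vertices enter with Green masses `a` and `b`, and the remaining terms are at most `(1 - cu)
m` times these masses. The elementary inequality `sq_sub_sq_le_of_decomposition` turns this into `β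
≤ 2 (1 + (1 - cu) m) m` (`cost_sub_cost_le`). The explicit bounds on `β` and its rate in `nl` follow
from this estimate.

The risk bound is the usual stability argument: exchanging a fresh example with a sampled one bounds
the mean generalization gap by `β`, and McDiarmid's inequality, proved here for averages over finite
products, controls the deviation. For the explicit bound with `√2`, either `λ_max(L) + γ ≥ 1` and it
dominates `β`, or the transductive error is at least 4, which no risk exceeds. -/

namespace SoftHarmonicProblem

/-! ### Normal equations, well-posedness and the Green function. -/

variable {n : ℕ} (p : SoftHarmonicProblem n)

/-- The matrix `C + L + γ I` of the normal equations. -/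
noncomputable def systemMatrix (l : Set (Fin n)) : Matrix (Fin n) (Fin n) ℝ :=
  Matrix.diagonal (p.weight l) + (p.laplacian + p.γ • (1 : Matrix (Fin n) (Fin n) ℝ))

theorem weight_of_mem {l : Set (Fin n)} {i : Fin n} (h : i ∈ l) : p.weight l i = 1 := if_pos h

theorem weight_of_notMem {l : Set (Fin n)} {i : Fin n} (h : i ∉ l) : p.weight l i = p.cu :=
  if_neg h

theorem target_of_mem {l : Set (Fin n)} {i : Fin n} (h : i ∈ l) : p.target l i = p.y i := if_pos h

theorem target_of_notMem {l : Set (Fin n)} {i : Fin n} (h : i ∉ l) : p.target l i = 0 :=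
  if_neg h

theorem cu_le_weight (l : Set (Fin n)) (i : Fin n) : p.cu ≤ p.weight l i := by
  by_cases h : i ∈ l
  · rw [p.weight_of_mem h]; exact p.cu_lt_one.le
  · rw [p.weight_of_notMem h]

theorem weight_add_pos (l : Set (Fin n)) (i : Fin n) : 0 < p.weight l i + p.γ := by
  linarith [p.cu_le_weight l i, p.cu_pos, p.γ_nonneg]

theorem weight_mul_target (l : Set (Fin n)) (i : Fin n) :
    p.weight l i * p.target l i = p.target l i := by
  by_cases h : i ∈ l
  · rw [p.weight_of_mem h, one_mul]
  · rw [p.target_of_notMem h, mul_zero]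

theorem laplacian_mulVec (u : Fin n → ℝ) (i : Fin n) :
    p.laplacian.mulVec u i = ∑ j, p.W i j * (u i - u j) := by
  rw [laplacian, Matrix.sub_mulVec, Pi.sub_apply, Matrix.mulVec_diagonal]
  simp only [Matrix.mulVec, dotProduct, mul_sub, Finset.sum_sub_distrib, Finset.sum_mul]

theorem systemMatrix_mulVec (l : Set (Fin n)) (u : Fin n → ℝ) (i : Fin n) :
    (p.systemMatrix l).mulVec u i =
      (p.weight l i + p.γ) * u i + ∑ j, p.W i j * (u i - u j) := by
  rw [systemMatrix, Matrix.add_mulVec, Matrix.add_mulVec, Pi.add_apply, Pi.add_apply,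
    laplacian_mulVec, Matrix.mulVec_diagonal, Matrix.smul_mulVec, Matrix.one_mulVec,
    Pi.smul_apply, smul_eq_mul]
  ring

theorem laplacian_isSymm : p.laplacian.IsSymm := by
  refine (Matrix.isSymm_diagonal _).sub (Matrix.IsSymm.ext fun i j => p.W_symm _ _)

theorem systemMatrix_isSymm (l : Set (Fin n)) : (p.systemMatrix l).IsSymm :=
  (Matrix.isSymm_diagonal _).add
    (p.laplacian_isSymm.add (Matrix.isSymm_one.smul _))

theorem dotProduct_mulVec_comm_of_isSymm {ι : Type*} [Fintype ι] {A : Matrix ι ι ℝ}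
    (hA : A.IsSymm) (u v : ι → ℝ) : u ⬝ᵥ A.mulVec v = v ⬝ᵥ A.mulVec u := by
  rw [Matrix.dotProduct_mulVec, ← Matrix.mulVec_transpose, hA.eq, dotProduct_comm]

/-- Symmetrizing in `i` and `j` gives `2 uᵀLu = ∑ W i j (u i - u j)²`. -/
theorem laplacian_quadratic_nonneg (u : Fin n → ℝ) : 0 ≤ u ⬝ᵥ p.laplacian.mulVec u := by
  have h1 : u ⬝ᵥ p.laplacian.mulVec u = ∑ i, ∑ j, p.W i j * (u i * (u i - u j)) := by
    simp only [dotProduct, laplacian_mulVec, Finset.mul_sum]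
    exact Finset.sum_congr rfl fun i _ => Finset.sum_congr rfl fun j _ => by ring
  have h2 : u ⬝ᵥ p.laplacian.mulVec u = ∑ i, ∑ j, p.W i j * (u j * (u j - u i)) := by
    rw [h1, Finset.sum_comm]
    exact Finset.sum_congr rfl fun i _ => Finset.sum_congr rfl fun j _ => by rw [p.W_symm]
  have h3 : 2 * (u ⬝ᵥ p.laplacian.mulVec u) = ∑ i, ∑ j, p.W i j * (u i - u j) ^ 2 := by
    rw [two_mul]
    nth_rewrite 1 [h1]
    rw [h2]
    simp only [← Finset.sum_add_distrib]
    exact Finset.sum_congr rfl fun i _ => Finset.sum_congr rfl fun j _ => by ring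
  have h4 : 0 ≤ ∑ i, ∑ j, p.W i j * (u i - u j) ^ 2 :=
    Finset.sum_nonneg fun i _ => Finset.sum_nonneg fun j _ =>
      mul_nonneg (p.W_nonneg i j) (sq_nonneg _)
  linarith

theorem le_systemMatrix_quadratic (l : Set (Fin n)) (u : Fin n → ℝ) :
    p.cu * (u ⬝ᵥ u) ≤ u ⬝ᵥ (p.systemMatrix l).mulVec u := by
  have h : u ⬝ᵥ (p.systemMatrix l).mulVec u =
      ∑ i, (p.weight l i + p.γ) * (u i * u i) + u ⬝ᵥ p.laplacian.mulVec u := by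
    simp only [dotProduct, systemMatrix_mulVec, laplacian_mulVec, ← Finset.sum_add_distrib]
    exact Finset.sum_congr rfl fun i _ => by ring
  rw [h]
  refine le_trans ?_ (le_add_of_nonneg_right (p.laplacian_quadratic_nonneg u))
  rw [dotProduct, Finset.mul_sum]
  refine Finset.sum_le_sum fun i _ => mul_le_mul_of_nonneg_right ?_ (mul_self_nonneg _)
  linarith [p.cu_le_weight l i, p.γ_nonneg]

theorem eq_zero_of_systemMatrix_quadratic_nonpos (l : Set (Fin n)) {u : Fin n → ℝ}
    (h : u ⬝ᵥ (p.systemMatrix l).mulVec u ≤ 0) : u = 0 := by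
  have h1 : u ⬝ᵥ u ≤ 0 :=
    nonpos_of_mul_nonpos_right ((p.le_systemMatrix_quadratic l u).trans h) p.cu_pos
  have h2 : 0 ≤ u ⬝ᵥ u := Finset.sum_nonneg fun i _ => mul_self_nonneg _
  exact dotProduct_self_eq_zero.1 (le_antisymm h1 h2)

theorem systemMatrix_mulVec_surjective (l : Set (Fin n)) :
    Function.Surjective (p.systemMatrix l).mulVec := by
  rw [Matrix.mulVec_surjective_iff_isUnit, ← Matrix.mulVec_injective_iff_isUnit]
  intro u v huv
  have h : (p.systemMatrix l).mulVec (u - v) = 0 := by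
    rw [Matrix.mulVec_sub, sub_eq_zero]; exact huv
  exact sub_eq_zero.1 (p.eq_zero_of_systemMatrix_quadratic_nonpos l (by rw [h]; simp))

theorem objective_add (l : Set (Fin n)) (u h : Fin n → ℝ) :
    p.objective l (u + h) = p.objective l u +
      2 * (h ⬝ᵥ ((p.systemMatrix l).mulVec u - p.target l)) +
        h ⬝ᵥ (p.systemMatrix l).mulVec h := by
  have expand : ∀ {A : Matrix (Fin n) (Fin n) ℝ}, A.IsSymm → ∀ v w : Fin n → ℝ,
      (v + w) ⬝ᵥ A.mulVec (v + w) =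
        v ⬝ᵥ A.mulVec v + 2 * (w ⬝ᵥ A.mulVec v) + w ⬝ᵥ A.mulVec w := by
    intro A hA v w
    rw [Matrix.mulVec_add, add_dotProduct, dotProduct_add, dotProduct_add,
      dotProduct_mulVec_comm_of_isSymm hA v w]
    ring
  have ht : (Matrix.diagonal (p.weight l)).mulVec (p.target l) = p.target l :=
    funext fun i => by rw [Matrix.mulVec_diagonal, weight_mul_target]
  rw [objective, objective, systemMatrix, add_sub_right_comm u h, expand (Matrix.isSymm_diagonal _),
    expand (p.laplacian_isSymm.add (Matrix.isSymm_one.smul _)), Matrix.mulVec_sub, ht]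
  simp only [Matrix.add_mulVec, dotProduct_add, dotProduct_sub]
  ring

/-- The solutions are characterized by the normal equations. -/
theorem isSolution_iff (l : Set (Fin n)) (u : Fin n → ℝ) :
    p.IsSolution l u ↔ (p.systemMatrix l).mulVec u = p.target l := by
  -- The objective is quadratic, so around a stationary point it equals its value there plus the
  -- quadratic form of the displacement.
  have aux : ∀ v w, (p.systemMatrix l).mulVec v = p.target l →
      p.objective l w = p.objective l v + (w - v) ⬝ᵥ (p.systemMatrix l).mulVec (w - v) := by
    intro v w hv
    have := p.objective_add l v (w - v)
    rwa [hv, sub_self, dotProduct_zero, mul_zero, add_zero, add_sub_cancel] at this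
  constructor
  · intro hu
    obtain ⟨v, hv⟩ := p.systemMatrix_mulVec_surjective l (p.target l)
    have h := p.eq_zero_of_systemMatrix_quadratic_nonpos l (u := u - v)
      (by linarith [aux v u hv, hu v])
    rwa [sub_eq_zero.1 h]
  · intro hu w
    rw [aux u w hu]
    refine le_add_of_nonneg_right (le_trans ?_ (p.le_systemMatrix_quadratic l _))
    exact mul_nonneg p.cu_pos.le (Finset.sum_nonneg fun i _ => mul_self_nonneg _)

theorem existsUnique_isSolution (l : Set (Fin n)) : ∃! u : Fin n → ℝ, p.IsSolution l u := by
  simp only [isSolution_iff]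
  obtain ⟨v, hv⟩ := p.systemMatrix_mulVec_surjective l (p.target l)
  refine ⟨v, hv, fun w hw => ?_⟩
  have h : (p.systemMatrix l).mulVec (w - v) = 0 := by
    rw [Matrix.mulVec_sub, sub_eq_zero]; exact hw.trans hv.symm
  exact sub_eq_zero.1 (p.eq_zero_of_systemMatrix_quadratic_nonpos l (by rw [h]; simp))

/-- Each eigenvalue is non-negative by its Rayleigh quotient, and `Real.sSup_nonneg` needs neither
nonemptiness nor boundedness. -/
theorem lambdaMax_nonneg : 0 ≤ p.lambdaMax := by
  refine Real.sSup_nonneg fun μ hμ => ?_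
  obtain ⟨v, hv⟩ := Module.End.HasEigenvalue.exists_hasEigenvector hμ
  have h1 : p.laplacian.mulVec v = μ • v := by
    have := hv.apply_eq_smul
    rwa [Matrix.toLin'_apply] at this
  have h2 := p.laplacian_quadratic_nonneg v
  rw [h1, dotProduct_smul, smul_eq_mul] at h2
  have h3 : 0 < v ⬝ᵥ v := lt_of_le_of_ne (Finset.sum_nonneg fun i _ => mul_self_nonneg _)
    (fun h => hv.2 (dotProduct_self_eq_zero.1 h.symm))
  exact nonneg_of_mul_nonneg_left h2 h3

/-- The Green function of the system at `i`: by the maximum principle it is non-negative and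
largest at `i`. -/
theorem exists_green (l : Set (Fin n)) (i : Fin n) : ∃ g : Fin n → ℝ,
    (∀ u : Fin n → ℝ, g ⬝ᵥ (p.systemMatrix l).mulVec u = u i) ∧
    (∀ v, 0 ≤ g v) ∧ (∀ v, g v ≤ g i) ∧ ∑ v, (p.weight l v + p.γ) * g v = 1 := by
  obtain ⟨g, hg⟩ := p.systemMatrix_mulVec_surjective l (Pi.single i 1)
  have hgu : ∀ u : Fin n → ℝ, g ⬝ᵥ (p.systemMatrix l).mulVec u = u i := by
    intro u
    rw [dotProduct_mulVec_comm_of_isSymm (p.systemMatrix_isSymm l), hg, dotProduct_single, mul_one]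
  have heq : ∀ v, (p.weight l v + p.γ) * g v + ∑ j, p.W v j * (g v - g j) =
      (Pi.single i 1 : Fin n → ℝ) v := fun v => by rw [← systemMatrix_mulVec, hg]
  have hne : (Finset.univ : Finset (Fin n)).Nonempty := ⟨i, Finset.mem_univ i⟩
  have hpos : ∀ v, 0 ≤ g v := by
    obtain ⟨w, -, hw⟩ := Finset.exists_min_image Finset.univ g hne
    -- At a minimizer the Laplacian term is non-positive while the right-hand side is non-negative,
    -- so the zeroth-order term forces `g w ≥ 0`.
    have h1 : ∑ j, p.W w j * (g w - g j) ≤ 0 := Finset.sum_nonpos fun j hj =>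
      mul_nonpos_of_nonneg_of_nonpos (p.W_nonneg w j) (sub_nonpos.2 (hw j hj))
    have h2 : (0 : ℝ) ≤ (Pi.single i 1 : Fin n → ℝ) w := by
      rw [Pi.single_apply]; split_ifs <;> norm_num
    have h3 : 0 ≤ g w := nonneg_of_mul_nonneg_right (by linarith [heq w]) (p.weight_add_pos l w)
    exact fun v => h3.trans (hw v (Finset.mem_univ v))
  refine ⟨g, hgu, hpos, ?_, ?_⟩
  · obtain ⟨w, -, hw⟩ := Finset.exists_max_image Finset.univ g hne
    by_cases hwi : w = i
    · subst hwi; exact fun v => hw v (Finset.mem_univ v)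
    -- A maximizer other than the source has right-hand side `0`, hence `g w ≤ 0`, and then `g ≤ 0 ≤
    -- g i` everywhere.
    have h1 : 0 ≤ ∑ j, p.W w j * (g w - g j) := Finset.sum_nonneg fun j hj =>
      mul_nonneg (p.W_nonneg w j) (sub_nonneg.2 (hw j hj))
    have h2 := heq w
    rw [Pi.single_eq_of_ne hwi] at h2
    have h3 : g w ≤ 0 := nonpos_of_mul_nonpos_right (by linarith) (p.weight_add_pos l w)
    exact fun v => ((hw v (Finset.mem_univ v)).trans h3).trans (hpos i)
  -- Testing against the constant function, which the Laplacian annihilates, gives the mass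
  -- identity.
  · have h := hgu 1
    rw [Pi.one_apply] at h
    rw [← h, dotProduct]
    refine Finset.sum_congr rfl fun v _ => ?_
    rw [systemMatrix_mulVec]
    simp [mul_comm]

end SoftHarmonicProblem

/-! ### Effect of replacing one example on the cost. -/

namespace SoftHarmonicProblem

variable {n : ℕ} (p : SoftHarmonicProblem n)

theorem abs_y (i : Fin n) : |p.y i| = 1 := by
  rcases p.y_mem i with h | h <;> simp [h]

theorem y_mul_self (i : Fin n) : p.y i * p.y i = 1 := by
  rcases p.y_mem i with h | h <;> simp [h]

theorem abs_y_mul_y (i j : Fin n) : |p.y i * p.y j| = 1 := by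
  rw [abs_mul, abs_y, abs_y, one_mul]

theorem one_add_γ_pos : 0 < 1 + p.γ := by linarith [p.γ_nonneg]

theorem inv_one_add_γ_le_one : (1 + p.γ)⁻¹ ≤ 1 :=
  inv_le_one_of_one_le₀ (by linarith [p.γ_nonneg])

/-- The prediction is a signed sum of Green masses over `l`, where the weight is `1 + γ`; the
weighted mass is at most 1. -/
theorem abs_solution_le {l : Set (Fin n)} {u : Fin n → ℝ} (hu : p.IsSolution l u) (i : Fin n) :
    |u i| ≤ (1 + p.γ)⁻¹ := by
  obtain ⟨g, hg, hpos, -, hsum⟩ := p.exists_green l i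
  rw [← hg u, (p.isSolution_iff l u).1 hu, dotProduct, ← one_div, le_div_iff₀ p.one_add_γ_pos]
  refine le_trans ?_ hsum.le
  refine (mul_le_mul_of_nonneg_right (Finset.abs_sum_le_sum_abs _ _) p.one_add_γ_pos.le).trans ?_
  rw [Finset.sum_mul]
  refine Finset.sum_le_sum fun v _ => ?_
  by_cases hv : v ∈ l
  · rw [p.target_of_mem hv, p.weight_of_mem hv, abs_mul, abs_y, abs_of_nonneg (hpos v), mul_one,
      mul_comm]
  · rw [p.target_of_notMem hv, mul_zero, abs_zero, zero_mul]
    exact mul_nonneg (p.weight_add_pos l v).le (hpos v)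

theorem cost_nonneg (u : Fin n → ℝ) (i : Fin n) : 0 ≤ p.cost u i := sq_nonneg _

theorem cost_eq (u : Fin n → ℝ) (i : Fin n) : p.cost u i = (1 - p.y i * u i) ^ 2 := by
  rcases p.y_mem i with h | h <;> rw [cost, h] <;> ring

theorem abs_y_mul_solution_le {l : Set (Fin n)} {u : Fin n → ℝ} (hu : p.IsSolution l u)
    (i j : Fin n) : |p.y i * u j| ≤ (1 + p.γ)⁻¹ := by
  rw [abs_mul, abs_y, one_mul]
  exact p.abs_solution_le hu j

theorem cost_le_four {l : Set (Fin n)} {u : Fin n → ℝ} (hu : p.IsSolution l u) (i : Fin n) :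
    p.cost u i ≤ 4 := by
  have h := abs_le.1 ((p.abs_y_mul_solution_le hu i i).trans p.inv_one_add_γ_le_one)
  rw [cost_eq]
  nlinarith

/-- Here `R + a σ + b w` is the old prediction and `R + b τ + a v` the new one, both multiplied by
the true label. The disjunction `h` excludes the one bad configuration, in which the new label is
wrong and `R` is too negative to compensate for `b > a`. -/
theorem sq_sub_sq_le_of_decomposition {m ε c R T a b O σ τ v w : ℝ}
    (hm : m ≤ 1) (hε : ε = 1 - c) (hc0 : 0 ≤ c) (hc1 : c ≤ 1)
    (ha : 0 ≤ a) (hb : 0 ≤ b) (hO : 0 ≤ O) (hsum : T + a + b + c * O = m)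
    (hR : |R| ≤ T) (hσ : |σ| ≤ 1) (hτ : |τ| ≤ 1) (hv : |v| ≤ ε) (hw : |w| ≤ ε)
    (h : τ = 1 ∨ 0 ≤ 2 * (R + m - a - b) + c * (a - b)) :
    (1 - (R + b * τ + a * v)) ^ 2 - (1 - (R + a * σ + b * w)) ^ 2 ≤ 2 * (1 + ε) * m := by
  rw [abs_le] at hR hσ hτ hv hw
  have hT : 0 ≤ T := by linarith
  have hcO : 0 ≤ c * O := mul_nonneg hc0 hO
  have hε0 : 0 ≤ ε := by linarith
  have hε1 : ε ≤ 1 := by linarith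
  have hbε : b * ε ≤ b := mul_le_of_le_one_right hb hε1
  have haε0 : 0 ≤ a * ε := mul_nonneg ha hε0
  have hbε0 : 0 ≤ b * ε := mul_nonneg hb hε0
  have hx : R + a * σ + b * w ≤ R + a + b * ε := by nlinarith
  have hx1 : R + a + b * ε ≤ 1 := by linarith
  -- With `x = R + a + b ε` bounding the old prediction from above and `z` the new one from below,
  -- the difference is at most `(x - z) (2 - x - z)`. For `s = a + b` this is at most `2 (1 + ε) s
  -- (1 + m - s)`, and `s (1 + m - s) ≤ m` because `(m - s) (1 - s) ≥ 0`.
  have key : ∀ z : ℝ, z ≤ R + b * τ + a * v → R + a + b * ε - z ≤ (1 + ε) * (a + b) →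
      2 - (R + a + b * ε) - z ≤ 2 + 2 * m - 2 * (a + b) → z ≤ 1 →
      (1 - (R + b * τ + a * v)) ^ 2 - (1 - (R + a * σ + b * w)) ^ 2 ≤ 2 * (1 + ε) * m := by
    intro z hz hd hs hz1
    have hlow : R + b * τ + a * v ≤ 1 := by nlinarith
    have e1 : (1 - (R + b * τ + a * v)) ^ 2 ≤ (1 - z) ^ 2 :=
      pow_le_pow_left₀ (by linarith) (by linarith) 2
    have e2 : (1 - (R + a + b * ε)) ^ 2 ≤ (1 - (R + a * σ + b * w)) ^ 2 :=
      pow_le_pow_left₀ (by linarith) (by linarith) 2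
    have e3 : (R + a + b * ε - z) * (2 - (R + a + b * ε) - z) ≤
        (1 + ε) * (a + b) * (2 + 2 * m - 2 * (a + b)) :=
      (mul_le_mul_of_nonneg_right hd (by linarith)).trans
        (mul_le_mul_of_nonneg_left hs (by positivity))
    have e4 : 0 ≤ (1 + ε) * ((m - (a + b)) * (1 - (a + b))) :=
      mul_nonneg (by linarith) (mul_nonneg (by linarith) (by linarith))
    nlinarith
  have haε : a * ε ≤ a := mul_le_of_le_one_right ha hε1
  rcases h with h | h
  · subst h
    refine key (R + b - a * ε) (by nlinarith) (by nlinarith) (by nlinarith) (by nlinarith)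
  · have hca : c * a = a - a * ε := by rw [hε]; ring
    have hcb : c * b = b - b * ε := by rw [hε]; ring
    refine key (R - b - a * ε) (by nlinarith) (by nlinarith) (by nlinarith) (by nlinarith)

open scoped Classical in
-- Passing from `l` to `l ∪ l'` changes the system only at `k ∈ l' \ l`, where the weight rises from
-- `cu` to `1`; this produces the term `(1 - cu) * u k`.
theorem solution_eq_of_green {l l' : Set (Fin n)} {i j k : Fin n}
    (hl : ∀ v ∈ l, v ∉ l' → v = j) (hl' : ∀ v ∈ l', v ∉ l → v = k) {g u : Fin n → ℝ}
    (hg : g ⬝ᵥ (p.systemMatrix (l ∪ l')).mulVec u = u i) (hu : p.IsSolution l u) :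
    u i = ∑ v, (if v ∈ l ∩ l' then g v * p.y v else 0) +
      (if j ∈ l \ l' then g j else 0) * p.y j +
      (if k ∈ l' \ l then g k else 0) * ((1 - p.cu) * u k) := by
  have hj : (if j ∈ l \ l' then g j else 0) * p.y j =
      ∑ v, if v = j then (if j ∈ l \ l' then g j else 0) * p.y j else 0 := by simp
  have hk : (if k ∈ l' \ l then g k else 0) * ((1 - p.cu) * u k) =
      ∑ v, if v = k then (if k ∈ l' \ l then g k else 0) * ((1 - p.cu) * u k) else 0 := by simp
  rw [hj, hk, ← Finset.sum_add_distrib, ← Finset.sum_add_distrib, ← hg, dotProduct]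
  refine Finset.sum_congr rfl fun v _ => ?_
  have h1 := congrFun ((p.isSolution_iff l u).1 hu) v
  rw [systemMatrix_mulVec] at h1
  have h2 : (p.systemMatrix (l ∪ l')).mulVec u v =
      p.target l v + (p.weight (l ∪ l') v - p.weight l v) * u v := by
    rw [systemMatrix_mulVec, ← h1]; ring
  rw [h2]
  have hlv := hl v
  have hlv' := hl' v
  by_cases hv : v ∈ l <;> by_cases hv' : v ∈ l'
  · have hvu : v ∈ l ∪ l' := Or.inl hv
    have a1 : ¬ (v = j ∧ j ∈ l \ l') := by rintro ⟨rfl, h⟩; exact h.2 hv'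
    have a2 : ¬ (v = k ∧ k ∈ l' \ l) := by rintro ⟨rfl, h⟩; exact h.2 hv
    rw [p.target_of_mem hv, p.weight_of_mem hv, p.weight_of_mem hvu]
    grind
  · have hvu : v ∈ l ∪ l' := Or.inl hv
    have a2 : ¬ (v = k ∧ k ∈ l' \ l) := by rintro ⟨rfl, h⟩; exact h.2 hv
    rw [p.target_of_mem hv, p.weight_of_mem hv, p.weight_of_mem hvu]
    grind
  · have hvu : v ∈ l ∪ l' := Or.inr hv'
    have a1 : ¬ (v = j ∧ j ∈ l \ l') := by rintro ⟨rfl, h⟩; exact h.2 hv'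
    rw [p.target_of_notMem hv, p.weight_of_notMem hv, p.weight_of_mem hvu]
    grind
  · have hvu : v ∉ l ∪ l' := fun h => h.elim hv hv'
    rw [p.target_of_notMem hv, p.weight_of_notMem hv, p.weight_of_notMem hvu]
    grind

open scoped Classical in
theorem sum_green_eq {l l' : Set (Fin n)} {j k : Fin n}
    (hl : ∀ v ∈ l, v ∉ l' → v = j) (hl' : ∀ v ∈ l', v ∉ l → v = k) {g : Fin n → ℝ}
    (hg : ∑ v, (p.weight (l ∪ l') v + p.γ) * g v = 1) :
    (1 + p.γ) * (∑ v, (if v ∈ l ∩ l' then g v else 0) +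
      (if j ∈ l \ l' then g j else 0) + (if k ∈ l' \ l then g k else 0)) +
      (p.cu + p.γ) * ∑ v, (if v ∈ l ∪ l' then 0 else g v) = 1 := by
  have hj : (if j ∈ l \ l' then g j else 0) =
      ∑ v, if v = j then (if j ∈ l \ l' then g j else 0) else 0 := by simp
  have hk : (if k ∈ l' \ l then g k else 0) =
      ∑ v, if v = k then (if k ∈ l' \ l then g k else 0) else 0 := by simp
  rw [← hg, hj, hk, ← Finset.sum_add_distrib, ← Finset.sum_add_distrib, Finset.mul_sum,
    Finset.mul_sum, ← Finset.sum_add_distrib]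
  refine Finset.sum_congr rfl fun v _ => ?_
  have hlv := hl v
  have hlv' := hl' v
  by_cases hvu : v ∈ l ∪ l'
  · rw [p.weight_of_mem hvu]
    grind
  · rw [p.weight_of_notMem hvu]
    grind

/-- Replacing one example changes the cost at each vertex by at most
`2 (1 + (1 - cu) / (1 + γ)) / (1 + γ)`. -/
theorem cost_sub_cost_le {l l' : Set (Fin n)} {j k : Fin n}
    (hl : ∀ v ∈ l, v ∉ l' → v = j) (hl' : ∀ v ∈ l', v ∉ l → v = k) {u u' : Fin n → ℝ}
    (hu : p.IsSolution l u) (hu' : p.IsSolution l' u') (i : Fin n) :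
    p.cost u' i - p.cost u i ≤
      2 * (1 + (1 - p.cu) * (1 + p.γ)⁻¹) * (1 + p.γ)⁻¹ := by
  classical
  obtain ⟨g, hg, hpos, hmax, hsum⟩ := p.exists_green (l ∪ l') i
  have e1 := p.solution_eq_of_green hl hl' (hg u) hu
  have e2 := p.solution_eq_of_green hl' hl (by rw [Set.union_comm]; exact hg u') hu'
  have e3 := p.sum_green_eq hl hl' hsum
  have hcomm : (∑ v, if v ∈ l' ∩ l then g v * p.y v else 0) =
      ∑ v, if v ∈ l ∩ l' then g v * p.y v else 0 :=
    Finset.sum_congr rfl fun v _ => if_congr and_comm rfl rfl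
  rw [hcomm] at e2
  have hγ := p.one_add_γ_pos
  set a := if j ∈ l \ l' then g j else 0 with ha
  set b := if k ∈ l' \ l then g k else 0 with hb
  set O := ∑ v, (if v ∈ l ∪ l' then 0 else g v) with hOdef
  set T := ∑ v, (if v ∈ l ∩ l' then g v else 0) with hTdef
  set R := ∑ v, (if v ∈ l ∩ l' then g v * p.y v else 0) with hRdef
  set m := (1 + p.γ)⁻¹ with hm
  have hγm : (1 + p.γ) * m = 1 := mul_inv_cancel₀ hγ.ne'
  have hm0 : 0 < m := inv_pos.2 hγ
  have ha0 : 0 ≤ a := by rw [ha]; split_ifs <;> simp [hpos]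
  have hb0 : 0 ≤ b := by rw [hb]; split_ifs <;> simp [hpos]
  have hO0 : 0 ≤ O := Finset.sum_nonneg fun v _ => by split_ifs <;> simp [hpos]
  have hRT : |p.y i * R| ≤ T := by
    rw [abs_mul, abs_y, one_mul]
    refine (Finset.abs_sum_le_sum_abs _ _).trans (Finset.sum_le_sum fun v _ => ?_)
    split_ifs
    · rw [abs_mul, abs_y, mul_one, abs_of_nonneg (hpos v)]
    · simp
  have hcc : (p.cu + p.γ) * m = 1 - (1 - p.cu) * m := by linear_combination hγm
  have hc0 : 0 ≤ (p.cu + p.γ) * m := mul_nonneg (by linarith [p.cu_pos, p.γ_nonneg]) hm0.le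
  have hε0 : 0 ≤ (1 - p.cu) * m := mul_nonneg (by linarith [p.cu_lt_one]) hm0.le
  have hsum' : T + a + b + (p.cu + p.γ) * m * O = m := by
    linear_combination m * e3 - (T + a + b) * hγm
  have hsmall : ∀ {l : Set (Fin n)} {u : Fin n → ℝ}, p.IsSolution l u → ∀ v,
      |p.y i * ((1 - p.cu) * u v)| ≤ (1 - p.cu) * m := by
    intro l u hu v
    rw [mul_left_comm, abs_mul, abs_of_nonneg (by linarith [p.cu_lt_one] : 0 ≤ 1 - p.cu)]
    exact mul_le_mul_of_nonneg_left (p.abs_y_mul_solution_le hu i v) (by linarith [p.cu_lt_one])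
  -- If `b ≤ a`, then `R ≥ -T` suffices. If `b > a`, then either `k = i`, where the labels agree
  -- trivially, or `b ≤ g i` by maximality and `i` is not a swapped vertex. In the latter case the
  -- mass `g i` pays for `b`: it sits in `R` with the right sign if `i ∈ l ∩ l'`, and in `O` if `i`
  -- is unlabeled.
  have hcase : p.y i * p.y k = 1 ∨
      0 ≤ 2 * (p.y i * R + m - a - b) + (p.cu + p.γ) * m * (a - b) := by
    have hR := abs_le.1 hRT
    have hcO : 0 ≤ (p.cu + p.γ) * m * O := mul_nonneg hc0 hO0
    have hc1 : (p.cu + p.γ) * m ≤ 1 := by linarith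
    by_cases hba : b ≤ a
    · right
      have := mul_nonneg hc0 (sub_nonneg.2 hba)
      linarith
    have hk : k ∈ l' \ l := by
      by_contra h
      rw [hb, if_neg h] at hba
      exact hba ha0
    by_cases hki : k = i
    · left; rw [hki, y_mul_self]
    right
    have hbi : b ≤ g i := by rw [hb, if_pos hk]; exact hmax k
    have hil : i ∉ l \ l' := by
      intro h
      have hij := hl i h.1 h.2
      rw [ha, if_pos (hij ▸ h), ← hij] at hba
      exact hba hbi
    have hprod : (p.cu + p.γ) * m * b ≤ (p.cu + p.γ) * m * g i :=
      mul_le_mul_of_nonneg_left hbi hc0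
    have hprod_a : 0 ≤ (p.cu + p.γ) * m * a := mul_nonneg hc0 ha0
    have hprod_g : (p.cu + p.γ) * m * g i ≤ g i := mul_le_of_le_one_left (hpos i) hc1
    have hprod_b : 0 ≤ (p.cu + p.γ) * m * b := mul_nonneg hc0 hb0
    by_cases hi : i ∈ l
    · have hi' : i ∈ l ∩ l' := ⟨hi, by by_contra h; exact hil ⟨hi, h⟩⟩
      have hRi : -T + 2 * g i ≤ p.y i * R := by
        have : 2 * g i = ∑ v, if v = i then 2 * g i else 0 := by simp
        rw [this, hTdef, hRdef, ← Finset.sum_neg_distrib, ← Finset.sum_add_distrib,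
          Finset.mul_sum]
        refine Finset.sum_le_sum fun v _ => ?_
        by_cases hvi : v = i
        · subst hvi
          rw [if_pos hi', if_pos rfl, if_pos hi']
          linear_combination (-g v) * p.y_mul_self v
        · rw [if_neg hvi, add_zero]
          split_ifs
          · have h1 := (abs_le.1 (p.abs_y_mul_y i v).le).1
            nlinarith [mul_le_mul_of_nonneg_left h1 (hpos v)]
          · simp
      linarith
    · by_cases hi' : i ∈ l'
      · exact absurd (hl' i hi' hi).symm hki
      have hiO : g i ≤ O := by
        have h1 : (if i ∈ l ∪ l' then 0 else g i) = g i := if_neg fun h => h.elim hi hi'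
        rw [← h1]
        exact Finset.single_le_sum (f := fun v => if v ∈ l ∪ l' then 0 else g v)
          (fun v _ => by split_ifs <;> simp [hpos]) (Finset.mem_univ i)
      have := mul_le_mul_of_nonneg_left hiO hc0
      linarith
  have hfinal := sq_sub_sq_le_of_decomposition (m := m) (ε := (1 - p.cu) * m)
    (c := (p.cu + p.γ) * m) (R := p.y i * R) (T := T) (a := a) (b := b) (O := O)
    (σ := p.y i * p.y j) (τ := p.y i * p.y k) (v := p.y i * ((1 - p.cu) * u' j))
    (w := p.y i * ((1 - p.cu) * u k)) p.inv_one_add_γ_le_one (by linarith) hc0 (by linarith)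
    ha0 hb0 hO0 hsum' hRT (p.abs_y_mul_y i j).le (p.abs_y_mul_y i k).le (hsmall hu' j)
    (hsmall hu k) hcase
  rw [cost_eq, cost_eq, e1, e2]
  convert hfinal using 3 <;> ring

end SoftHarmonicProblem

/-! ### Explicit bounds on the stability coefficient and its rate. -/

namespace SoftHarmonicProblem

variable {n : ℕ} (p : SoftHarmonicProblem n)

theorem le_of_mem_costChanges {nl : ℕ} {r : ℝ} (hr : r ∈ p.costChanges nl) :
    r ≤ 2 * (1 + (1 - p.cu) * (1 + p.γ)⁻¹) * (1 + p.γ)⁻¹ := by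
  obtain ⟨S, S', u, u', i, ⟨k, hk⟩, hu, hu', rfl⟩ := hr
  have h1 : ∀ v ∈ Set.range S, v ∉ Set.range S' → v = S k := by
    rintro _ ⟨j, rfl⟩ hv
    by_contra h
    exact hv ⟨j, (hk j fun e => h (by rw [e])).symm⟩
  have h2 : ∀ v ∈ Set.range S', v ∉ Set.range S → v = S' k := by
    rintro _ ⟨j, rfl⟩ hv
    by_contra h
    exact hv ⟨j, hk j fun e => h (by rw [e])⟩
  exact abs_sub_le_iff.2 ⟨p.cost_sub_cost_le h2 h1 hu' hu i, p.cost_sub_cost_le h1 h2 hu hu' i⟩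

theorem zero_mem_costChanges {nl : ℕ} (hn : 0 < n) (hnl : 0 < nl) :
    0 ∈ p.costChanges nl := by
  obtain ⟨u, hu, -⟩ := p.existsUnique_isSolution (Set.range fun _ : Fin nl => (⟨0, hn⟩ : Fin n))
  exact ⟨_, _, u, u, ⟨0, hn⟩, ⟨⟨0, hnl⟩, fun _ _ => rfl⟩, hu, hu, by simp⟩

theorem isLUB_stability {nl : ℕ} (hn : 0 < n) (hnl : 0 < nl) :
    IsLUB (p.costChanges nl) (p.stability nl) :=
  isLUB_csSup ⟨0, p.zero_mem_costChanges hn hnl⟩ ⟨_, fun _ => p.le_of_mem_costChanges⟩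

theorem stability_nonneg {nl : ℕ} (hn : 0 < n) (hnl : 0 < nl) : 0 ≤ p.stability nl :=
  (p.isLUB_stability hn hnl).1 (p.zero_mem_costChanges hn hnl)

theorem stability_le {nl : ℕ} (hn : 0 < n) (hnl : 0 < nl) :
    p.stability nl ≤ 2 * (1 + (1 - p.cu) * (1 + p.γ)⁻¹) * (1 + p.γ)⁻¹ :=
  (p.isLUB_stability hn hnl).2 fun _ => p.le_of_mem_costChanges

theorem one_sub_cu_mul_le : (1 - p.cu) * (1 + p.γ)⁻¹ ≤ 1 - p.cu :=
  mul_le_of_le_one_right (by linarith [p.cu_lt_one]) p.inv_one_add_γ_le_one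

theorem stability_le_four_div {nl : ℕ} (hn : 0 < n) (hnl : 0 < nl) :
    p.stability nl ≤ 4 / (p.γ + 1) := by
  refine (p.stability_le hn hnl).trans ?_
  rw [div_eq_mul_inv, add_comm p.γ 1]
  refine mul_le_mul_of_nonneg_right ?_ (inv_nonneg.2 p.one_add_γ_pos.le)
  linarith [p.one_sub_cu_mul_le, p.cu_pos]

theorem sqrt_cu_pos : 0 < √p.cu := Real.sqrt_pos.2 p.cu_pos

theorem sqrt_cu_le_one : √p.cu ≤ 1 :=
  Real.sqrt_le_iff.2 ⟨zero_le_one, by linarith [p.cu_lt_one]⟩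

theorem sqrt_ratio_nonneg : 0 ≤ (1 - √p.cu) / √p.cu :=
  div_nonneg (sub_nonneg.2 p.sqrt_cu_le_one) p.sqrt_cu_pos.le

theorem le_stabilityBound (nl : ℕ) (a : ℝ) : 2 * (a / (p.γ + 1)) ≤ p.stabilityBound nl a := by
  have h1 := p.sqrt_ratio_nonneg
  have h2 : 0 ≤ (p.lambdaMax + p.γ) / (p.γ ^ 2 + 1) :=
    div_nonneg (add_nonneg p.lambdaMax_nonneg p.γ_nonneg) (by positivity)
  rw [stabilityBound]
  have : 0 ≤ √(2 * (nl : ℝ)) * ((1 - √p.cu) / √p.cu) *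
      ((p.lambdaMax + p.γ) / (p.γ ^ 2 + 1)) := by positivity
  linarith

theorem stability_le_stabilityBound_two {nl : ℕ} (hn : 0 < n) (hnl : 0 < nl) :
    p.stability nl ≤ p.stabilityBound nl 2 := by
  refine (p.stability_le_four_div hn hnl).trans (le_trans (le_of_eq ?_) (p.le_stabilityBound nl 2))
  ring

/-- Used with `x = √cu`. The square of `x (2 - x²)` peaks at `x² = 2 / 3` with value `32 / 27 < 2`.
-/
theorem two_sub_sq_le_sqrt_two_div {x : ℝ} (h0 : 0 < x) (h1 : x ≤ 1) : 2 - x ^ 2 ≤ √2 / x := by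
  rw [le_div_iff₀ h0]
  refine Real.le_sqrt_of_sq_le ?_
  nlinarith [sq_nonneg (x ^ 2 - 2 / 3), sq_nonneg x, mul_nonneg h0.le (sub_nonneg.2 h1),
    mul_nonneg (sq_nonneg (3 * x ^ 2 - 2)) (sub_nonneg.2 (pow_le_one₀ h0.le h1 : x ^ 2 ≤ 1))]

theorem stability_le_stabilityBound_sqrt_two {nl : ℕ} (hn : 0 < n) (hnl : 0 < nl)
    (h : 1 ≤ p.lambdaMax + p.γ) : p.stability nl ≤ p.stabilityBound nl √2 := by
  have hγ := p.γ_nonneg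
  have hm : 0 < (1 + p.γ)⁻¹ := inv_pos.2 p.one_add_γ_pos
  have hx0 := p.sqrt_cu_pos
  have hratio : (1 + p.γ)⁻¹ ≤ (p.lambdaMax + p.γ) / (p.γ ^ 2 + 1) := by
    rw [inv_eq_one_div, div_le_div_iff₀ p.one_add_γ_pos (by positivity)]
    nlinarith [p.lambdaMax_nonneg, mul_nonneg p.lambdaMax_nonneg hγ, sq_nonneg (p.γ - 1)]
  have hroot : √2 ≤ √(2 * (nl : ℝ)) := by
    refine Real.sqrt_le_sqrt ?_
    have : (1 : ℝ) ≤ nl := Nat.one_le_cast.2 hnl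
    linarith
  have hterm : √2 * ((1 - √p.cu) / √p.cu) * (1 + p.γ)⁻¹ ≤
      √(2 * (nl : ℝ)) * ((1 - √p.cu) / √p.cu) * ((p.lambdaMax + p.γ) / (p.γ ^ 2 + 1)) :=
    mul_le_mul (mul_le_mul_of_nonneg_right hroot p.sqrt_ratio_nonneg) hratio hm.le
      (mul_nonneg (Real.sqrt_nonneg _) p.sqrt_ratio_nonneg)
  have hcu : 1 + (1 - p.cu) * (1 + p.γ)⁻¹ ≤ √2 / √p.cu := by
    have h1 := two_sub_sq_le_sqrt_two_div hx0 p.sqrt_cu_le_one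
    rw [Real.sq_sqrt p.cu_pos.le] at h1
    linarith [p.one_sub_cu_mul_le]
  -- Writing `1 / √cu = 1 + (1 - √cu) / √cu` separates the two summands of the explicit bound.
  have hsplit : √2 / √p.cu * (1 + p.γ)⁻¹ =
      √2 / (p.γ + 1) + √2 * ((1 - √p.cu) / √p.cu) * (1 + p.γ)⁻¹ := by
    rw [add_comm p.γ 1]
    field_simp
    ring
  have hmul := mul_le_mul_of_nonneg_right hcu hm.le
  have := p.stability_le hn hnl
  rw [stabilityBound]
  linarith

theorem nl_mul_sqrt_le {κ γ : ℝ} (hκ : 0 < κ) {nl : ℕ} (hnl : 0 < nl)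
    (h : κ * (nl : ℝ) ^ (3 / 2 : ℝ) ≤ γ) : nl * √(nl : ℝ) ≤ γ / κ := by
  have hnl' : (0 : ℝ) < nl := Nat.cast_pos.2 hnl
  rw [le_div_iff₀ hκ]
  refine le_trans (le_of_eq ?_) h
  have : (nl : ℝ) ^ (3 / 2 : ℝ) = nl * √(nl : ℝ) := by
    rw [Real.sqrt_eq_rpow, ← Real.rpow_one_add' hnl'.le (by norm_num)]
    norm_num
  rw [this]
  ring

theorem stability_le_div {κ : ℝ} (hκ : 0 < κ) {nl : ℕ} (hn : 0 < n) (hnl : 0 < nl)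
    (h : κ * (nl : ℝ) ^ (3 / 2 : ℝ) ≤ p.γ) : p.stability nl ≤ 4 / κ / nl := by
  have hnl' : (1 : ℝ) ≤ nl := Nat.one_le_cast.2 hnl
  have h1 := nl_mul_sqrt_le hκ hnl h
  rw [le_div_iff₀ hκ] at h1
  refine (p.stability_le_four_div hn hnl).trans ?_
  rw [div_div]
  refine div_le_div_of_nonneg_left (by norm_num) (by positivity) ?_
  have h2 : (nl : ℝ) ≤ nl * √(nl : ℝ) :=
    le_mul_of_one_le_right (by linarith) (Real.one_le_sqrt.2 hnl')
  nlinarith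

theorem stabilityBound_sqrt_two_le_div {κ c M : ℝ} (hκ : 0 < κ) (hc : 0 < c) {nl : ℕ}
    (hnl : 0 < nl) (hcu : c ≤ p.cu) (hM : p.lambdaMax ≤ M * p.γ)
    (h : κ * (nl : ℝ) ^ (3 / 2 : ℝ) ≤ p.γ) :
    p.stabilityBound nl √2 ≤ 2 * √2 * (1 + (M + 1) / √c) / κ / nl := by
  have hnl' : (1 : ℝ) ≤ nl := Nat.one_le_cast.2 hnl
  have hnl0 : (0 : ℝ) < nl := by linarith
  have hroot : 1 ≤ √(nl : ℝ) := Real.one_le_sqrt.2 hnl'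
  have h1 := nl_mul_sqrt_le hκ hnl h
  rw [le_div_iff₀ hκ] at h1
  have hκnl : 0 < κ * nl := by positivity
  have hle : κ * nl ≤ p.γ := by nlinarith
  have hγ : 0 < p.γ := hκnl.trans_le hle
  have hM0 : 0 ≤ M := nonneg_of_mul_nonneg_left (p.lambdaMax_nonneg.trans hM) hγ
  have hsc : 0 < √c := Real.sqrt_pos.2 hc
  have e1 : √2 / (p.γ + 1) ≤ √2 / (κ * nl) :=
    div_le_div_of_nonneg_left (Real.sqrt_nonneg _) hκnl (by linarith)
  have e2 : (1 - √p.cu) / √p.cu ≤ 1 / √c :=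
    div_le_div₀ zero_le_one (by linarith [p.sqrt_cu_pos]) hsc (Real.sqrt_le_sqrt hcu)
  have e3 : (p.lambdaMax + p.γ) / (p.γ ^ 2 + 1) ≤ (M + 1) / p.γ := by
    rw [div_le_div_iff₀ (by positivity) hγ]
    nlinarith [mul_le_mul_of_nonneg_right hM hγ.le]
  -- The exponent `3 / 2` is needed here: one factor `√nl` of `γ` cancels the root in the bound, and
  -- `nl` remains.
  have e4 : √(nl : ℝ) * ((M + 1) / p.γ) ≤ (M + 1) / (κ * nl) := by
    rw [mul_div_assoc', div_le_div_iff₀ hγ hκnl]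
    nlinarith
  have e5 : √(2 * (nl : ℝ)) * ((1 - √p.cu) / √p.cu) *
      ((p.lambdaMax + p.γ) / (p.γ ^ 2 + 1)) ≤ √2 * (1 / √c) * ((M + 1) / (κ * nl)) := by
    calc √(2 * (nl : ℝ)) * ((1 - √p.cu) / √p.cu) * ((p.lambdaMax + p.γ) / (p.γ ^ 2 + 1))
        ≤ √(2 * (nl : ℝ)) * (1 / √c) * ((M + 1) / p.γ) :=
          mul_le_mul (mul_le_mul_of_nonneg_left e2 (Real.sqrt_nonneg _)) e3
            (div_nonneg (add_nonneg p.lambdaMax_nonneg hγ.le) (by positivity)) (by positivity)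
      _ = √2 * (1 / √c) * (√(nl : ℝ) * ((M + 1) / p.γ)) := by
          rw [Real.sqrt_mul zero_le_two]; ring
      _ ≤ √2 * (1 / √c) * ((M + 1) / (κ * nl)) :=
          mul_le_mul_of_nonneg_left e4 (by positivity)
  have e6 : 2 * √2 * (1 + (M + 1) / √c) / κ / nl =
      2 * (√2 / (κ * nl) + √2 * (1 / √c) * ((M + 1) / (κ * nl))) := by
    field_simp
  rw [stabilityBound, e6]
  linarith

end SoftHarmonicProblem

/-! ### McDiarmid's inequality and generalization from stability on finite types. -/

open scoped BigOperators

theorem integral_uniformOn_univ {α : Type*} [Fintype α] [MeasurableSpace α]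
    [MeasurableSingletonClass α] [Nonempty α] (f : α → ℝ) :
    ∫ a, f a ∂(uniformOn (Set.univ : Set α)) = 𝔼 a, f a := by
  rw [integral_fintype (Integrable.of_finite), Fintype.expect_eq_sum_div_card, Finset.sum_div]
  refine Finset.sum_congr rfl fun a _ => ?_
  rw [measureReal_def, uniformOn_univ]
  simp [div_eq_inv_mul]

/-- Hoeffding's lemma for the uniform distribution on a finite type. -/
theorem expect_exp_mul_sub_expect_le {α : Type*} [Fintype α] [Nonempty α] {f : α → ℝ} {c : ℝ}
    (hf : ∀ a b, f a - f b ≤ c) (t : ℝ) :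
    𝔼 a, Real.exp (t * (f a - 𝔼 b, f b)) ≤ Real.exp (t ^ 2 * c ^ 2 / 8) := by
  let _ : MeasurableSpace α := ⊤
  obtain ⟨b, hb⟩ := Finite.exists_min f
  have : IsProbabilityMeasure (uniformOn (Set.univ : Set α)) :=
    isProbabilityMeasure_uniformOn Set.finite_univ Set.univ_nonempty
  have h := (hasSubgaussianMGF_of_mem_Icc (μ := uniformOn (Set.univ : Set α)) (X := f)
    (a := f b) (b := f b + c) (measurable_from_top).aemeasurable
    (Filter.Eventually.of_forall fun a => ⟨hb a, by linarith [hf a b]⟩)).mgf_le t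
  rw [mgf, integral_uniformOn_univ, integral_uniformOn_univ] at h
  refine h.trans_eq ?_
  congr 1
  simp only [add_sub_cancel_left, NNReal.coe_pow, NNReal.coe_div, coe_nnnorm, Real.norm_eq_abs,
    NNReal.coe_ofNat, div_pow, sq_abs]
  ring

theorem Fin.expect_cons {α : Type*} [Fintype α] {N : ℕ} (h : (Fin (N + 1) → α) → ℝ) :
    𝔼 S, h S = 𝔼 a, 𝔼 S, h (Fin.cons a S) := by
  rw [← Finset.expect_product' Finset.univ Finset.univ fun a S => h (Fin.cons a S),
    Finset.univ_product_univ]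
  exact (Fintype.expect_equiv (Fin.consEquiv fun _ => α) _ _ fun x => rfl).symm

/-- The exponential moment bound behind McDiarmid's inequality, for independent uniform samples
from a finite type. -/
theorem expect_exp_mul_sub_expect_le_of_bounded_differences {α : Type*} [Fintype α] [Nonempty α]
    {c : ℝ} (t : ℝ) : ∀ {N : ℕ} {f : (Fin N → α) → ℝ},
    (∀ S S' k, (∀ j, j ≠ k → S j = S' j) → f S - f S' ≤ c) →
    𝔼 S, Real.exp (t * (f S - 𝔼 S', f S')) ≤ Real.exp (N * (t ^ 2 * c ^ 2 / 8))
  | 0, f, _ => by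
    have h : f = fun _ => f default := funext fun S => congrArg f (Subsingleton.elim _ _)
    rw [h]
    simp
  | N + 1, f, hf => by
    have ih : ∀ a, 𝔼 S, Real.exp (t * (f (Fin.cons a S) - 𝔼 S', f (Fin.cons a S'))) ≤
        Real.exp (N * (t ^ 2 * c ^ 2 / 8)) := fun a =>
      expect_exp_mul_sub_expect_le_of_bounded_differences t
        (f := fun S => f (Fin.cons a S)) fun S S' k h => hf _ _ k.succ fun j hj => by
          refine Fin.cases (fun _ => rfl) (fun j hj => ?_) j hj
          rw [Fin.cons_succ, Fin.cons_succ]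
          exact h j fun e => hj (congrArg _ e)
    -- Averaging out the later examples preserves the bounded difference in the first one, so
    -- Hoeffding's lemma applies to this conditional mean.
    have hF : ∀ a b, (𝔼 S, f (Fin.cons a S)) - 𝔼 S, f (Fin.cons b S) ≤ c := by
      intro a b
      rw [← Finset.expect_sub_distrib]
      refine Finset.expect_le Finset.univ_nonempty fun S _ => hf _ _ 0 fun j hj => ?_
      obtain ⟨j, rfl⟩ := Fin.exists_succ_eq.2 hj
      rw [Fin.cons_succ, Fin.cons_succ]
    have hH := expect_exp_mul_sub_expect_le hF t
    rw [Fin.expect_cons, Fin.expect_cons f]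
    set F : α → ℝ := fun a => 𝔼 S, f (Fin.cons a S) with hFdef
    have hsplit : ∀ a, 𝔼 S, Real.exp (t * (f (Fin.cons a S) - 𝔼 b, F b)) =
        Real.exp (t * (F a - 𝔼 b, F b)) *
          𝔼 S, Real.exp (t * (f (Fin.cons a S) - F a)) := by
      intro a
      rw [Finset.mul_expect]
      refine Finset.expect_congr rfl fun S _ => ?_
      rw [← Real.exp_add]
      congr 1
      ring
    calc 𝔼 a, 𝔼 S, Real.exp (t * (f (Fin.cons a S) - 𝔼 b, F b))
        = 𝔼 a, Real.exp (t * (F a - 𝔼 b, F b)) *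
          𝔼 S, Real.exp (t * (f (Fin.cons a S) - F a)) :=
          Finset.expect_congr rfl fun a _ => hsplit a
      _ ≤ 𝔼 a, Real.exp (t * (F a - 𝔼 b, F b)) * Real.exp (N * (t ^ 2 * c ^ 2 / 8)) :=
          Finset.expect_le_expect fun a _ =>
            mul_le_mul_of_nonneg_left (ih a) (Real.exp_pos _).le
      _ = (𝔼 a, Real.exp (t * (F a - 𝔼 b, F b))) * Real.exp (N * (t ^ 2 * c ^ 2 / 8)) :=
          (Finset.expect_mul _ _ _).symm
      _ ≤ Real.exp (t ^ 2 * c ^ 2 / 8) * Real.exp (N * (t ^ 2 * c ^ 2 / 8)) :=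
          mul_le_mul_of_nonneg_right hH (Real.exp_pos _).le
      _ = Real.exp ((N + 1 : ℕ) * (t ^ 2 * c ^ 2 / 8)) := by
          rw [← Real.exp_add]
          congr 1
          push_cast
          ring

open scoped Classical in
/-- McDiarmid's inequality for independent uniform samples from a finite type. -/
theorem expect_ite_le_exp_neg_of_bounded_differences {α : Type*} [Fintype α] [Nonempty α]
    {N : ℕ} (hN : 0 < N) {c : ℝ} (hc : 0 < c) {f : (Fin N → α) → ℝ}
    (hf : ∀ S S' k, (∀ j, j ≠ k → S j = S' j) → f S - f S' ≤ c) {r : ℝ} (hr : 0 ≤ r) :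
    𝔼 S, (if 𝔼 S', f S' + c * √(N * r / 2) ≤ f S then (1 : ℝ) else 0) ≤ Real.exp (-r) := by
  have hN' : (0 : ℝ) < N := Nat.cast_pos.2 hN
  set τ := c * √(N * r / 2) with hτ
  have hτ0 : 0 ≤ τ := by positivity
  have hτ2 : τ ^ 2 = c ^ 2 * (N * r / 2) := by
    rw [hτ, mul_pow, Real.sq_sqrt (by positivity)]
  -- The minimizer of the Chernoff exponent `-t τ + N t² c² / 8`, whose minimum is `-r`.
  set t := 4 * τ / (N * c ^ 2) with ht
  have ht0 : 0 ≤ t := by positivity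
  have e1 : t * τ = 2 * r := by
    have : t * τ = 4 * τ ^ 2 / (N * c ^ 2) := by rw [ht]; ring
    rw [this, hτ2]
    field_simp
    ring
  have e2 : N * (t ^ 2 * c ^ 2 / 8) = r := by
    have : N * (t ^ 2 * c ^ 2 / 8) = 2 * τ ^ 2 / (N * c ^ 2) := by
      rw [ht]
      field_simp
      ring
    rw [this, hτ2]
    field_simp
  calc 𝔼 S, (if 𝔼 S', f S' + τ ≤ f S then (1 : ℝ) else 0)
      ≤ 𝔼 S, Real.exp (-(t * τ)) * Real.exp (t * (f S - 𝔼 S', f S')) := by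
        refine Finset.expect_le_expect fun S _ => ?_
        split_ifs with h
        · rw [← Real.exp_add]
          refine Real.one_le_exp ?_
          nlinarith [mul_le_mul_of_nonneg_left h ht0]
        · positivity
    _ = Real.exp (-(t * τ)) * 𝔼 S, Real.exp (t * (f S - 𝔼 S', f S')) :=
        (Finset.mul_expect _ _ _).symm
    _ ≤ Real.exp (-(t * τ)) * Real.exp (N * (t ^ 2 * c ^ 2 / 8)) :=
        mul_le_mul_of_nonneg_left
          (expect_exp_mul_sub_expect_le_of_bounded_differences t hf) (Real.exp_pos _).le
    _ = Real.exp (-r) := by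
        rw [← Real.exp_add, e1, e2]
        congr 1
        ring

/-- A fresh uniform example can be exchanged with the `k`-th example of a uniform sample. -/
theorem expect_expect_update {α ι : Type*} [Fintype α] [Nonempty α] [Fintype ι] [DecidableEq ι]
    (h : (ι → α) → α → ℝ) (k : ι) :
    𝔼 S, 𝔼 z, h (Function.update S k z) z = 𝔼 S, h S (S k) := by
  -- Swapping `z` with the `k`-th entry is a bijection of pairs, hence preserves the uniform
  -- average.
  have hinv : Function.Involutive
      fun x : (ι → α) × α => (Function.update x.1 k x.2, x.1 k) := by
    rintro ⟨S, z⟩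
    simp
  have h1 : 𝔼 S : ι → α, 𝔼 _z : α, h S (S k) = 𝔼 S, h S (S k) :=
    Finset.expect_congr rfl fun S _ => Fintype.expect_const _
  rw [← h1, ← Finset.expect_product' Finset.univ Finset.univ fun S z => h (Function.update S k z) z,
    ← Finset.expect_product' Finset.univ Finset.univ fun (S : ι → α) (_ : α) => h S (S k),
    Finset.univ_product_univ]
  exact Fintype.expect_equiv hinv.toPerm _ _ fun x => by simp

open scoped Classical in
/-- The generalization bound for uniformly stable losses bounded by `M`, for independent uniform
samples from a finite type. -/
theorem expect_ite_generalization_gap_le_exp_neg {α : Type*} [Fintype α] [Nonempty α]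
    {N : ℕ} (hN : 0 < N) {β M : ℝ} (hβ : 0 ≤ β) (hM : 0 < M) {A : (Fin N → α) → α → ℝ}
    (hstable : ∀ S S' k z, (∀ j, j ≠ k → S j = S' j) → |A S z - A S' z| ≤ β)
    (hnonneg : ∀ S z, 0 ≤ A S z) (hle : ∀ S z, A S z ≤ M) {r : ℝ} (hr : 0 ≤ r) :
    𝔼 S, (if β + (2 * β + M / N) * √(N * r / 2) ≤ 𝔼 z, A S z - 𝔼 k, A S (S k)
      then (1 : ℝ) else 0) ≤ Real.exp (-r) := by
  have hN' : (0 : ℝ) < N := Nat.cast_pos.2 hN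
  have : Nonempty (Fin N) := ⟨⟨0, hN⟩⟩
  set f : (Fin N → α) → ℝ := fun S => 𝔼 z, A S z - 𝔼 k, A S (S k) with hf
  have hmean : 𝔼 S, f S ≤ β := by
    have hk : ∀ k, 𝔼 S, 𝔼 z, A S z - 𝔼 S, A S (S k) ≤ β := by
      intro k
      rw [← expect_expect_update A k, ← Finset.expect_sub_distrib]
      refine Finset.expect_le Finset.univ_nonempty fun S _ => ?_
      rw [← Finset.expect_sub_distrib]
      refine Finset.expect_le Finset.univ_nonempty fun z _ => ?_
      exact (le_abs_self _).trans (hstable _ _ k z fun j hj => by rw [Function.update_of_ne hj])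
    have h1 : 𝔼 k, (𝔼 S, 𝔼 z, A S z - 𝔼 S, A S (S k)) ≤ β :=
      Finset.expect_le Finset.univ_nonempty fun k _ => hk k
    have h2 : 𝔼 S, 𝔼 k, A S (S k) = 𝔼 k, 𝔼 S, A S (S k) := Finset.expect_comm _ _ _
    have h3 : 𝔼 _k : Fin N, 𝔼 S, 𝔼 z, A S z = 𝔼 S, 𝔼 z, A S z := Fintype.expect_const _
    have h4 : 𝔼 S, f S = 𝔼 S, 𝔼 z, A S z - 𝔼 S, 𝔼 k, A S (S k) :=
      Finset.expect_sub_distrib _ _ _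
    rw [Finset.expect_sub_distrib, h3] at h1
    rwa [h4, h2]
  have hdiff : ∀ S S' k, (∀ j, j ≠ k → S j = S' j) → f S - f S' ≤ 2 * β + M / N := by
    intro S S' k h
    have h1 : 𝔼 z, A S z - 𝔼 z, A S' z ≤ β := by
      rw [← Finset.expect_sub_distrib]
      exact Finset.expect_le Finset.univ_nonempty fun z _ =>
        (le_abs_self _).trans (hstable _ _ k z h)
    have h2 : 𝔼 j, A S' (S' j) - 𝔼 j, A S (S j) ≤ β + M / N := by
      rw [← Finset.expect_sub_distrib]
      -- Only the replaced example is evaluated at a different point; its loss changes by at most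
      -- `M`, which averages to `M / N`.
      have h3 : ∀ j, A S' (S' j) - A S (S j) ≤ β + if j = k then M else 0 := by
        intro j
        split_ifs with hj
        · linarith [hle S' (S' j), hnonneg S (S j)]
        · rw [h j hj, add_zero]
          exact (le_abs_self _).trans (abs_sub_comm (A S _) (A S' _) ▸ hstable _ _ k _ h)
      refine (Finset.expect_le_expect fun j _ => h3 j).trans_eq ?_
      rw [Finset.expect_add_distrib, Fintype.expect_const, Fintype.expect_eq_sum_div_card]
      simp
    simp only [hf]
    linarith
  refine le_trans (Finset.expect_le_expect fun S _ => ?_)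
    (expect_ite_le_exp_neg_of_bounded_differences hN
      (by positivity : 0 < 2 * β + M / N) hdiff hr)
  split_ifs with h1 h2
  · exact le_rfl
  · exact absurd (by linarith) h2
  · exact zero_le_one
  · exact le_rfl

open scoped Classical in
-- By independence each tuple has probability `n⁻ᴺ`, so events about the random sample become plain
-- averages.
theorem measureReal_preimage_eq_expect_of_iIndepFun {n N : ℕ} {Ω : Type*}
    [MeasurableSpace Ω] {μ : Measure Ω} [IsProbabilityMeasure μ] {s : Fin N → Ω → Fin n}
    (hs : ∀ k, Measurable (s k)) (hind : iIndepFun s μ)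
    (hunif : ∀ k i, μ.real (s k ⁻¹' {i}) = 1 / (n : ℝ)) (B : Set (Fin N → Fin n)) :
    μ.real ((fun ω k => s k ω) ⁻¹' B) = 𝔼 S, if S ∈ B then (1 : ℝ) else 0 := by
  have hmeas : Measurable fun ω k => s k ω := measurable_pi_lambda _ hs
  have h1 : ∀ S : Fin N → Fin n, μ.real ((fun ω k => s k ω) ⁻¹' {S}) = (1 / (n : ℝ)) ^ N := by
    intro S
    have h2 : (fun ω k => s k ω) ⁻¹' {S} = ⋂ k ∈ Finset.univ, s k ⁻¹' {S k} := by
      ext ω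
      simp [funext_iff]
    rw [h2, measureReal_def, hind.measure_inter_preimage_eq_mul _ fun k _ =>
      measurableSet_singleton _, ENNReal.toReal_prod]
    simp only [← measureReal_def, hunif, Finset.prod_const, Finset.card_univ, Fintype.card_fin]
  have h2 : (fun ω k => s k ω) ⁻¹' B =
      ⋃ S ∈ Finset.univ.filter (· ∈ B), (fun ω k => s k ω) ⁻¹' {S} := by
    ext ω
    simp
  rw [h2, measureReal_biUnion_finset
    (fun S _ S' _ hne => Disjoint.preimage _ (Set.disjoint_singleton.2 hne))
    (fun S _ => hmeas (measurableSet_singleton S)), Finset.sum_congr rfl fun S _ => h1 S,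
    Fintype.expect_eq_sum_div_card, Finset.sum_boole]
  simp [div_eq_mul_inv]

/-! ### The transductive error and the risk bounds. -/

open scoped BigOperators

theorem transductiveError_mono {β β' : ℝ} (h : β ≤ β') (nl : ℕ) (δ : ℝ) :
    transductiveError β nl δ ≤ transductiveError β' nl δ := by
  unfold transductiveError
  gcongr

/-- The left side equals the transductive error with `nl * β + 2` in place of `nl * β + 4`. -/
theorem mcdiarmid_threshold_le_transductiveError (β : ℝ) {nl : ℕ} (hnl : 0 < nl) {δ : ℝ} :
    β + (2 * β + 4 / nl) * √(nl * Real.log (2 / δ) / 2) ≤ transductiveError β nl δ := by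
  have hnl' : (0 : ℝ) < nl := Nat.cast_pos.2 hnl
  have h1 : √(nl * Real.log (2 / δ) / 2) = nl / 2 * √(2 * Real.log (2 / δ) / nl) := by
    rw [← Real.sqrt_sq (by positivity : (0 : ℝ) ≤ nl / 2), ← Real.sqrt_mul (by positivity)]
    congr 1
    field_simp
  have h2 : (2 * β + 4 / nl) * (nl / 2 * √(2 * Real.log (2 / δ) / nl)) =
      √(2 * Real.log (2 / δ) / nl) * (nl * β + 2) := by
    field_simp
    ring
  rw [transductiveError, h1, h2]
  gcongr
  norm_num

/-- Since `ln (2 / δ) ≥ 1 / 2`, the error exceeds `(nl + 4) / √nl`, which is at least 4 by the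
arithmetic-geometric mean inequality. This makes the risk bound trivial when `β ≥ 1`. -/
theorem four_le_transductiveError {β : ℝ} (hβ : 1 ≤ β) {nl : ℕ} (hnl : 0 < nl) {δ : ℝ}
    (hδ0 : 0 < δ) (hδ1 : δ < 1) : 4 ≤ transductiveError β nl δ := by
  have hnl' : (0 : ℝ) < nl := Nat.cast_pos.2 hnl
  have hlog : 1 / 2 ≤ Real.log (2 / δ) := by
    have h1 : Real.log 2 ≤ Real.log (2 / δ) :=
      Real.log_le_log two_pos (by rw [le_div_iff₀ hδ0]; linarith)
    linarith [Real.log_two_gt_d9]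
  have h1 : √(1 / (nl : ℝ)) ≤ √(2 * Real.log (2 / δ) / nl) :=
    Real.sqrt_le_sqrt (by gcongr; linarith)
  have h2 : √(1 / (nl : ℝ)) * (nl + 4) ≤ √(2 * Real.log (2 / δ) / nl) * (nl * β + 4) := by
    refine mul_le_mul h1 ?_ (by positivity) (Real.sqrt_nonneg _)
    nlinarith
  have h3 : 4 ≤ √(1 / (nl : ℝ)) * (nl + 4) := by
    have hs : 0 < √(nl : ℝ) := Real.sqrt_pos.2 hnl'
    have hss := Real.sq_sqrt hnl'.le
    rw [Real.sqrt_div zero_le_one, Real.sqrt_one, div_mul_eq_mul_div, one_mul, le_div_iff₀ hs]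
    nlinarith [sq_nonneg (√(nl : ℝ) - 2)]
  rw [transductiveError]
  linarith

namespace SoftHarmonicProblem

variable {n : ℕ} (p : SoftHarmonicProblem n)

theorem risk_eq_expect (u : Fin n → ℝ) : p.risk u = 𝔼 i, p.cost u i := by
  rw [risk, Fintype.expect_eq_sum_div_card, Fintype.card_fin, one_div, div_eq_inv_mul]

theorem empiricalRisk_eq_expect {nl : ℕ} (S : Fin nl → Fin n) (u : Fin n → ℝ) :
    p.empiricalRisk S u = 𝔼 k, p.cost u (S k) := by
  rw [empiricalRisk, Fintype.expect_eq_sum_div_card, Fintype.card_fin, one_div, div_eq_inv_mul]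

theorem empiricalRisk_nonneg {nl : ℕ} (S : Fin nl → Fin n) (u : Fin n → ℝ) :
    0 ≤ p.empiricalRisk S u := by
  rw [empiricalRisk_eq_expect]
  exact Finset.expect_nonneg fun k _ => p.cost_nonneg u (S k)

theorem risk_le_four (hn : 0 < n) {l : Set (Fin n)} {u : Fin n → ℝ} (hu : p.IsSolution l u) :
    p.risk u ≤ 4 := by
  have : Nonempty (Fin n) := ⟨⟨0, hn⟩⟩
  rw [risk_eq_expect]
  exact Finset.expect_le Finset.univ_nonempty fun i _ => p.cost_le_four hu i

/-- The risk bound with the stability coefficient, for independent uniform labeled examples. -/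
theorem one_sub_le_measureReal_risk_le {nl : ℕ} (hn : 0 < n) (hnl : 0 < nl) {Ω : Type*}
    [MeasurableSpace Ω] {μ : Measure Ω} [IsProbabilityMeasure μ] {s : Fin nl → Ω → Fin n}
    (hs : ∀ k, Measurable (s k)) (hind : iIndepFun s μ)
    (hunif : ∀ k i, μ.real (s k ⁻¹' {i}) = 1 / (n : ℝ)) {δ : ℝ} (hδ0 : 0 < δ) (hδ1 : δ < 1) :
    1 - δ ≤ μ.real {ω | ∀ u : Fin n → ℝ, p.IsSolution (Set.range fun k => s k ω) u →
      p.risk u ≤ p.empiricalRisk (fun k => s k ω) u +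
        transductiveError (p.stability nl) nl δ} := by
  classical
  have : Nonempty (Fin n) := ⟨⟨0, hn⟩⟩
  choose sol hsol huniq using p.existsUnique_isSolution
  have hr : 0 ≤ Real.log (2 / δ) :=
    Real.log_nonneg (by rw [le_div_iff₀ hδ0]; linarith)
  have hgap := expect_ite_generalization_gap_le_exp_neg hnl (p.stability_nonneg hn hnl)
    (by norm_num : (0 : ℝ) < 4) (A := fun (S : Fin nl → Fin n) i => p.cost (sol (Set.range S)) i)
    (fun S S' k i h => (p.isLUB_stability hn hnl).1
      ⟨S, S', _, _, i, ⟨k, h⟩, hsol _, hsol _, rfl⟩)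
    (fun S i => p.cost_nonneg _ i) (fun S i => p.cost_le_four (hsol _) i) hr
  set B : Set (Fin nl → Fin n) := {S | p.stability nl + (2 * p.stability nl + 4 / nl) *
    √(nl * Real.log (2 / δ) / 2) ≤ 𝔼 i, p.cost (sol (Set.range S)) i -
      𝔼 k, p.cost (sol (Set.range S)) (S k)}
  have hbad : μ.real ((fun ω k => s k ω) ⁻¹' B) ≤ δ := by
    rw [measureReal_preimage_eq_expect_of_iIndepFun hs hind hunif]
    refine (le_of_eq ?_).trans (hgap.trans ?_)
    · exact Finset.expect_congr rfl fun S _ => if_congr Iff.rfl rfl rfl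
    -- The deviation is one-sided, so the failure probability is even at most `δ / 2`.
    · rw [Real.exp_neg, Real.exp_log (by positivity), inv_div]
      linarith
  have hmeas : MeasurableSet ((fun ω k => s k ω) ⁻¹' B) :=
    measurable_pi_lambda _ hs B.toFinite.measurableSet
  calc 1 - δ ≤ 1 - μ.real ((fun ω k => s k ω) ⁻¹' B) := by linarith
    _ = μ.real ((fun ω k => s k ω) ⁻¹' B)ᶜ := (probReal_compl_eq_one_sub hmeas).symm
    _ ≤ _ := by
      refine measureReal_mono fun ω hω u hu => ?_
      rw [huniq _ u hu, risk_eq_expect, empiricalRisk_eq_expect]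
      have h1 : 𝔼 i, p.cost (sol (Set.range fun k => s k ω)) i -
          𝔼 k, p.cost (sol (Set.range fun k => s k ω)) (s k ω) <
          p.stability nl + (2 * p.stability nl + 4 / nl) * √(nl * Real.log (2 / δ) / 2) :=
        lt_of_not_ge fun h => hω h
      have h2 := mcdiarmid_threshold_le_transductiveError (p.stability nl) hnl (δ := δ)
      linarith

/-- The risk bound with the explicit stability bound, which is trivial if `λ_max(L) + γ < 1`. -/
theorem one_sub_le_measureReal_risk_le_stabilityBound {nl : ℕ} (hn : 0 < n) (hnl : 0 < nl)
    {Ω : Type*} [MeasurableSpace Ω] {μ : Measure Ω} [IsProbabilityMeasure μ]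
    {s : Fin nl → Ω → Fin n} (hs : ∀ k, Measurable (s k)) (hind : iIndepFun s μ)
    (hunif : ∀ k i, μ.real (s k ⁻¹' {i}) = 1 / (n : ℝ)) {δ : ℝ} (hδ0 : 0 < δ) (hδ1 : δ < 1) :
    1 - δ ≤ μ.real {ω | ∀ u : Fin n → ℝ, p.IsSolution (Set.range fun k => s k ω) u →
      p.risk u ≤ p.empiricalRisk (fun k => s k ω) u +
        transductiveError (p.stabilityBound nl √2) nl δ} := by
  by_cases h : 1 ≤ p.lambdaMax + p.γ
  · refine (p.one_sub_le_measureReal_risk_le hn hnl hs hind hunif hδ0 hδ1).trans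
      (measureReal_mono fun ω hω u hu => (hω u hu).trans ?_)
    have := transductiveError_mono (p.stability_le_stabilityBound_sqrt_two hn hnl h) nl δ
    linarith
  -- Now `2 √2 / (γ + 1) ≥ 1` already makes the explicit bound at least 1, so the transductive error
  -- is at least 4 and the event is everything.
  · have hγ : p.γ < 1 := by linarith [p.lambdaMax_nonneg]
    have h1 : 1 ≤ p.stabilityBound nl √2 := by
      refine le_trans ?_ (p.le_stabilityBound nl √2)
      have h2 : 1 ≤ √2 := Real.one_le_sqrt.2 one_le_two
      rw [mul_div_assoc', le_div_iff₀ (by linarith [p.γ_nonneg])]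
      linarith
    have h3 : {ω | ∀ u : Fin n → ℝ, p.IsSolution (Set.range fun k => s k ω) u →
        p.risk u ≤ p.empiricalRisk (fun k => s k ω) u +
          transductiveError (p.stabilityBound nl √2) nl δ} = Set.univ :=
      Set.eq_univ_of_forall fun ω u hu => by
        linarith [p.risk_le_four hn hu, p.empiricalRisk_nonneg (fun k => s k ω) u,
          four_le_transductiveError h1 hnl hδ0 hδ1]
    rw [h3, probReal_univ]
    linarith

end SoftHarmonicProblem

theorem mainTheorem3 :
    -- the bounds for a fixed problem
    (∀ (n nl : ℕ) (_ : 0 < n) (_ : 0 < nl) (p : SoftHarmonicProblem n),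
      -- the solution exists and is unique, and `β` is a genuine supremum
      (∀ l : Set (Fin n), ∃! ℓ : Fin n → ℝ, p.IsSolution l ℓ) ∧
      IsLUB (p.costChanges nl) (p.stability nl) ∧
      -- explicit bounds on the stability coefficient
      p.stability nl ≤ p.stabilityBound nl 2 ∧
      (1 ≤ p.lambdaMax + p.γ → p.stability nl ≤ p.stabilityBound nl √2) ∧
      -- the risk bound for i.i.d. uniformly distributed labeled examples `s 0, …, s (nl - 1)`
      (∀ (Ω : Type*) [MeasurableSpace Ω] (μ : Measure Ω) [IsProbabilityMeasure μ]
        (s : Fin nl → Ω → Fin n) (_ : ∀ k, Measurable (s k)) (_ : iIndepFun s μ)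
        (_ : ∀ k i, μ.real (s k ⁻¹' {i}) = 1 / (n : ℝ)) (δ : ℝ) (_ : 0 < δ) (_ : δ < 1),
        1 - δ ≤ μ.real {ω | ∀ ℓ : Fin n → ℝ, p.IsSolution (Set.range fun k => s k ω) ℓ →
          p.risk ℓ ≤ p.empiricalRisk (fun k => s k ω) ℓ +
            transductiveError (p.stability nl) nl δ} ∧
        1 - δ ≤ μ.real {ω | ∀ ℓ : Fin n → ℝ, p.IsSolution (Set.range fun k => s k ω) ℓ →
          p.risk ℓ ≤ p.empiricalRisk (fun k => s k ω) ℓ +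
            transductiveError (p.stabilityBound nl √2) nl δ})) ∧
    -- `β = O(1 / nl)` when `γ = Ω(nl ^ (3 / 2))`
    (∀ κ : ℝ, 0 < κ → ∃ K : ℝ, ∀ (n nl : ℕ) (_ : 0 < n) (_ : 0 < nl) (p : SoftHarmonicProblem n),
      κ * (nl : ℝ) ^ (3 / 2 : ℝ) ≤ p.γ → p.stability nl ≤ K / (nl : ℝ)) ∧
    -- the same rate for the explicit bound
    (∀ κ c M : ℝ, 0 < κ → 0 < c → ∃ K : ℝ,
      ∀ (n nl : ℕ) (_ : 0 < n) (_ : 0 < nl) (p : SoftHarmonicProblem n),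
      c ≤ p.cu → p.lambdaMax ≤ M * p.γ → κ * (nl : ℝ) ^ (3 / 2 : ℝ) ≤ p.γ →
      p.stabilityBound nl √2 ≤ K / (nl : ℝ)) := by
  refine ⟨fun n nl hn hnl p => ⟨p.existsUnique_isSolution, p.isLUB_stability hn hnl,
    p.stability_le_stabilityBound_two hn hnl, p.stability_le_stabilityBound_sqrt_two hn hnl, ?_⟩,
    fun κ hκ => ⟨4 / κ, fun n nl hn hnl p h => p.stability_le_div hκ hn hnl h⟩,
    fun κ c M hκ hc => ⟨2 * √2 * (1 + (M + 1) / √c) / κ, fun n nl _ hnl p hcu hM h =>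
      p.stabilityBound_sqrt_two_le_div hκ hc hnl hcu hM h⟩⟩
  intro Ω _ μ _ s hs hind hunif δ hδ0 hδ1
  exact ⟨p.one_sub_le_measureReal_risk_le hn hnl hs hind hunif hδ0 hδ1,
    p.one_sub_le_measureReal_risk_le_stabilityBound hn hnl hs hind hunif hδ0 hδ1⟩
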